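/- Let $R$ be a field. A connected graded algebra over $R$ is an associative unital $\mathbb{N}$-graded $R$-algebra $A=\bigoplus_{n\ge 0}A_n$ whose unit map $R\to A_0$ is an isomorphism; morphisms are the degree-preserving $R$-algebra homomorphisms. Let $\mathcal{A}_{CG}$ be the category of cogroups in the category of connected graded algebras with respect to the categorical coproduct $\ast$ (the free product of algebras), and let $\mathcal{A}_{CG}^{co}$ be its full subcategory on the cogroups whose underlying algebra is graded commutative, i.e. $ab=(-1)^{pq}ba$ for $a\in A_p$, $b\in A_q$. Let $A(0)$ be the graded algebra $R$ (concentrated in degree $0$) with its unique cogroup structure. For $n>0$ let $A(n)$ be the polynomial ring $R[X]$ on a generator $X$ of degree $n$, with the cogroup structure whose comultiplication $R[X]\to R[X]\ast R[X]$ is given by $X\mapsto X'+X''$ and whose inverse is given by $X\mapsto -X$, where $X'$ and $X''$ are the images of $X$ under the inclusions of the first and the second factor. (1) The cogroups $A(0),A(1),A(2),\dots$ if $\operatorname{char}R=2$, and $A(0),A(2),A(4),\dots$ if $\operatorname{char}R\neq 2$, are objects of $\mathcal{A}_{CG}^{co}$, and the inclusion into $\mathcal{A}_{CG}^{co}$ of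 the full subcategory consisting of them is an equivalence of categories. (2) Let $A(m)$ and $A(n)$ be objects of $\mathcal{A}_{CG}^{co}$. If $m=n>0$, then $\mathcal{A}_{CG}^{co}(A(m),A(n))\cong R$, where $c\in R$ corresponds to the morphism with $X\mapsto cX$; under this bijection the multiplication of $R$ corresponds to composition, and the addition of $R$ to the convolution of morphisms, in which the sum of $f$ and $g$ is the composite $A(n)\to A(n)\ast A(n)\xrightarrow{(f,g)}A(n)$ of the comultiplication and the morphism that restricts to $f$ and $g$ on the two factors. Otherwise $\mathcal{A}_{CG}^{co}(A(m),A(n))$ has exactly one element, that is, it is $0$. -/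

import Mathlib

universe u

open CategoryTheory MonoidalCategory CartesianMonoidalCategory Limits

noncomputable section

/-! ## The free product of two algebras -/

/-- The relations that turn the tensor algebra on `A × B` into the free product of `A` and `B`:
both copies become multiplicative and unital. -/
inductive FreeProd.Rel (R : Type u) [CommRing R] (A B : Type u) [Ring A] [Algebra R A]
    [Ring B] [Algebra R B] : TensorAlgebra R (A × B) → TensorAlgebra R (A × B) → Prop
  | one_left : FreeProd.Rel R A B (TensorAlgebra.ι R ((1 : A), (0 : B))) 1
  | one_right : FreeProd.Rel R A B (TensorAlgebra.ι R ((0 : A), (1 : B))) 1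
  | mul_left (a a' : A) : FreeProd.Rel R A B (TensorAlgebra.ι R (a * a', (0 : B)))
      (TensorAlgebra.ι R (a, (0 : B)) * TensorAlgebra.ι R (a', (0 : B)))
  | mul_right (b b' : B) : FreeProd.Rel R A B (TensorAlgebra.ι R ((0 : A), b * b'))
      (TensorAlgebra.ι R ((0 : A), b) * TensorAlgebra.ι R ((0 : A), b'))

/-- The free product `A ∗ B` of two (noncommutative) `R`-algebras. -/
def FreeProd (R : Type u) [CommRing R] (A B : Type u) [Ring A] [Algebra R A]
    [Ring B] [Algebra R B] : Type u :=
  RingQuot (FreeProd.Rel R A B)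

namespace FreeProd

variable (R : Type u) [CommRing R] (A B : Type u) [Ring A] [Algebra R A] [Ring B] [Algebra R B]

instance : Ring (FreeProd R A B) := inferInstanceAs (Ring (RingQuot (FreeProd.Rel R A B)))

instance : Algebra R (FreeProd R A B) :=
  inferInstanceAs (Algebra R (RingQuot (FreeProd.Rel R A B)))

/-- The quotient map from the tensor algebra. -/
def mk : TensorAlgebra R (A × B) →ₐ[R] FreeProd R A B :=
  RingQuot.mkAlgHom R (FreeProd.Rel R A B)

variable {R A B} in
theorem mk_rel {x y : TensorAlgebra R (A × B)} (h : FreeProd.Rel R A B x y) :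
    mk R A B x = mk R A B y :=
  RingQuot.mkAlgHom_rel R h

/-- The canonical inclusion of the first factor. -/
def inl : A →ₐ[R] FreeProd R A B :=
  AlgHom.ofLinearMap
    ((mk R A B).toLinearMap ∘ₗ TensorAlgebra.ι R ∘ₗ LinearMap.inl R A B)
    (by simpa using mk_rel (FreeProd.Rel.one_left (R := R) (A := A) (B := B)))
    (fun a a' ↦ by simpa using mk_rel (FreeProd.Rel.mul_left (R := R) (A := A) (B := B) a a'))

/-- The canonical inclusion of the second factor. -/
def inr : B →ₐ[R] FreeProd R A B :=
  AlgHom.ofLinearMap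
    ((mk R A B).toLinearMap ∘ₗ TensorAlgebra.ι R ∘ₗ LinearMap.inr R A B)
    (by simpa using mk_rel (FreeProd.Rel.one_right (R := R) (A := A) (B := B)))
    (fun a a' ↦ by simpa using mk_rel (FreeProd.Rel.mul_right (R := R) (A := A) (B := B) a a'))

theorem mk_ι (x : A × B) :
    mk R A B (TensorAlgebra.ι R x) = inl R A B x.1 + inr R A B x.2 := by
  obtain ⟨a, b⟩ := x
  have : ((a, b) : A × B) = (a, 0) + (0, b) := by simp
  rw [this, map_add, map_add]
  simp [inl, inr]

variable {R A B} {C : Type u} [Semiring C] [Algebra R C]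

/-- The algebra homomorphism out of the free product with given restrictions to both factors. -/
def lift (f : A →ₐ[R] C) (g : B →ₐ[R] C) : FreeProd R A B →ₐ[R] C :=
  RingQuot.liftAlgHom R ⟨TensorAlgebra.lift R (f.toLinearMap.coprod g.toLinearMap), by
    intro x y h
    cases h <;> simp⟩

theorem lift_mk (f : A →ₐ[R] C) (g : B →ₐ[R] C) (x : TensorAlgebra R (A × B)) :
    lift f g (mk R A B x) = TensorAlgebra.lift R (f.toLinearMap.coprod g.toLinearMap) x :=
  RingQuot.liftAlgHom_mkAlgHom_apply R _ _ x

@[simp]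
theorem lift_inl (f : A →ₐ[R] C) (g : B →ₐ[R] C) (a : A) : lift f g (inl R A B a) = f a := by
  change lift f g (mk R A B (TensorAlgebra.ι R (a, 0))) = f a
  simp [lift_mk]

@[simp]
theorem lift_inr (f : A →ₐ[R] C) (g : B →ₐ[R] C) (b : B) : lift f g (inr R A B b) = g b := by
  change lift f g (mk R A B (TensorAlgebra.ι R (0, b))) = g b
  simp [lift_mk]

theorem algHom_ext {f g : FreeProd R A B →ₐ[R] C} (h₁ : ∀ a, f (inl R A B a) = g (inl R A B a))
    (h₂ : ∀ b, f (inr R A B b) = g (inr R A B b)) : f = g := by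
  apply RingQuot.ringQuot_ext'
  apply TensorAlgebra.hom_ext
  apply LinearMap.ext
  intro x
  change f (mk R A B (TensorAlgebra.ι R x)) = g (mk R A B (TensorAlgebra.ι R x))
  rw [mk_ι, map_add, map_add, h₁, h₂]

/-! ### The grading of the free product -/

variable (𝒜 : ℕ → Submodule R A) (ℬ : ℕ → Submodule R B)

/-- `Word 𝒜 ℬ n x` says that `x` is a product of homogeneous elements of the two factors whose
degrees add up to `n`. -/
inductive Word : ℕ → FreeProd R A B → Prop
  | one : Word 0 1
  | left {i n : ℕ} {a : A} {x : FreeProd R A B} (ha : a ∈ 𝒜 i) (hx : Word n x) :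
      Word (i + n) (inl R A B a * x)
  | right {i n : ℕ} {b : B} {x : FreeProd R A B} (hb : b ∈ ℬ i) (hx : Word n x) :
      Word (i + n) (inr R A B b * x)

/-- The degree `n` part of the free product. -/
def gr (n : ℕ) : Submodule R (FreeProd R A B) := Submodule.span R {x | Word 𝒜 ℬ n x}

variable {𝒜 ℬ}

theorem Word.mul {m n : ℕ} {x y : FreeProd R A B} (hx : Word 𝒜 ℬ m x) (hy : Word 𝒜 ℬ n y) :
    Word 𝒜 ℬ (m + n) (x * y) := by
  induction hx with
  | one => simpa using hy
  | left ha _ ih => rw [add_assoc, mul_assoc]; exact Word.left ha ih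
  | right hb _ ih => rw [add_assoc, mul_assoc]; exact Word.right hb ih

theorem inl_mem {i : ℕ} {a : A} (ha : a ∈ 𝒜 i) : inl R A B a ∈ gr 𝒜 ℬ i :=
  Submodule.subset_span (by simpa using Word.left (ℬ := ℬ) ha Word.one)

theorem inr_mem {i : ℕ} {b : B} (hb : b ∈ ℬ i) : inr R A B b ∈ gr 𝒜 ℬ i :=
  Submodule.subset_span (by simpa using Word.right (𝒜 := 𝒜) hb Word.one)

instance : SetLike.GradedMonoid (gr 𝒜 ℬ) where
  one_mem := Submodule.subset_span Word.one
  mul_mem i j x y hx hy := by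
    have h := Submodule.mul_mem_mul hx hy
    rw [gr, gr, Submodule.span_mul_span] at h
    refine Submodule.span_mono ?_ h
    rintro _ ⟨x, hx, y, hy, rfl⟩
    exact Word.mul hx hy

theorem lift_mem_of_mem {𝒞 : ℕ → Submodule R C} [SetLike.GradedMonoid 𝒞]
    {f : A →ₐ[R] C} {g : B →ₐ[R] C} (hf : ∀ {i a}, a ∈ 𝒜 i → f a ∈ 𝒞 i)
    (hg : ∀ {i b}, b ∈ ℬ i → g b ∈ 𝒞 i) {n : ℕ} {x : FreeProd R A B} (hx : x ∈ gr 𝒜 ℬ n) :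
    lift f g x ∈ 𝒞 n := by
  suffices gr 𝒜 ℬ n ≤ (𝒞 n).comap (lift f g).toLinearMap from this hx
  rw [gr, Submodule.span_le]
  intro y hy
  change lift f g y ∈ 𝒞 n
  clear hx
  induction hy with
  | one => rw [map_one]; exact SetLike.GradedOne.one_mem
  | left ha _ ih => rw [map_mul, lift_inl]; exact SetLike.mul_mem_graded (hf ha) ih
  | right hb _ ih => rw [map_mul, lift_inr]; exact SetLike.mul_mem_graded (hg hb) ih

variable (𝒜 ℬ)

section

variable [GradedAlgebra 𝒜]

/-- The map `A → ⨁ i, (A ∗ B)_i` that sends `a` to its homogeneous components. -/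
def decomposeLeft : A →ₐ[R] DirectSum ℕ (fun i ↦ gr 𝒜 ℬ i) :=
  (DirectSum.toAlgebra R (fun i ↦ 𝒜 i)
    (fun i ↦ DirectSum.lof R ℕ (fun i ↦ gr 𝒜 ℬ i) i ∘ₗ
      ((inl R A B).toLinearMap.restrict (p := 𝒜 i) (q := gr 𝒜 ℬ i) fun _ h ↦ inl_mem h))
    (by
      rw [DirectSum.one_def]
      exact congrArg (DirectSum.of (fun i ↦ gr 𝒜 ℬ i) 0) (Subtype.ext (map_one (inl R A B))))
    (by
      intro i j a a'
      simp only [LinearMap.comp_apply, DirectSum.lof_eq_of]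
      rw [DirectSum.of_mul_of]
      exact congrArg (DirectSum.of (fun i ↦ gr 𝒜 ℬ i) (i + j))
        (Subtype.ext (map_mul (inl R A B) (a : A) (a' : A))))).comp
  (DirectSum.decomposeAlgEquiv 𝒜).toAlgHom

theorem decomposeLeft_of_mem {i : ℕ} {a : A} (ha : a ∈ 𝒜 i) :
    decomposeLeft 𝒜 ℬ a = DirectSum.of (fun i ↦ gr 𝒜 ℬ i) i ⟨inl R A B a, inl_mem ha⟩ := by
  simp only [decomposeLeft, AlgHom.comp_apply]
  have h : (DirectSum.decomposeAlgEquiv 𝒜).toAlgHom a = DirectSum.of (fun i ↦ 𝒜 i) i ⟨a, ha⟩ :=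
    DirectSum.decompose_of_mem 𝒜 ha
  rw [h]
  exact DirectSum.toAddMonoid_of
    (fun i ↦ (DirectSum.lof R ℕ (fun i ↦ gr 𝒜 ℬ i) i ∘ₗ
      ((inl R A B).toLinearMap.restrict (p := 𝒜 i) (q := gr 𝒜 ℬ i)
        fun _ h ↦ inl_mem h)).toAddMonoidHom) i ⟨a, ha⟩

end

section

variable [GradedAlgebra ℬ]

/-- The map `B → ⨁ i, (A ∗ B)_i` that sends `b` to its homogeneous components. -/
def decomposeRight : B →ₐ[R] DirectSum ℕ (fun i ↦ gr 𝒜 ℬ i) :=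
  (DirectSum.toAlgebra R (fun i ↦ ℬ i)
    (fun i ↦ DirectSum.lof R ℕ (fun i ↦ gr 𝒜 ℬ i) i ∘ₗ
      ((inr R A B).toLinearMap.restrict (p := ℬ i) (q := gr 𝒜 ℬ i) fun _ h ↦ inr_mem h))
    (by
      rw [DirectSum.one_def]
      exact congrArg (DirectSum.of (fun i ↦ gr 𝒜 ℬ i) 0) (Subtype.ext (map_one (inr R A B))))
    (by
      intro i j a a'
      simp only [LinearMap.comp_apply, DirectSum.lof_eq_of]
      rw [DirectSum.of_mul_of]
      exact congrArg (DirectSum.of (fun i ↦ gr 𝒜 ℬ i) (i + j))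
        (Subtype.ext (map_mul (inr R A B) (a : B) (a' : B))))).comp
  (DirectSum.decomposeAlgEquiv ℬ).toAlgHom

theorem decomposeRight_of_mem {i : ℕ} {b : B} (hb : b ∈ ℬ i) :
    decomposeRight 𝒜 ℬ b = DirectSum.of (fun i ↦ gr 𝒜 ℬ i) i ⟨inr R A B b, inr_mem hb⟩ := by
  simp only [decomposeRight, AlgHom.comp_apply]
  have h : (DirectSum.decomposeAlgEquiv ℬ).toAlgHom b = DirectSum.of (fun i ↦ ℬ i) i ⟨b, hb⟩ :=
    DirectSum.decompose_of_mem ℬ hb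
  rw [h]
  exact DirectSum.toAddMonoid_of
    (fun i ↦ (DirectSum.lof R ℕ (fun i ↦ gr 𝒜 ℬ i) i ∘ₗ
      ((inr R A B).toLinearMap.restrict (p := ℬ i) (q := gr 𝒜 ℬ i)
        fun _ h ↦ inr_mem h)).toAddMonoidHom) i ⟨b, hb⟩

end

variable [GradedAlgebra 𝒜] [GradedAlgebra ℬ]

theorem lift_decompose_of_word {n : ℕ} {x : FreeProd R A B} (hx : Word 𝒜 ℬ n x) :
    lift (decomposeLeft 𝒜 ℬ) (decomposeRight 𝒜 ℬ) x =
      DirectSum.of (fun i ↦ gr 𝒜 ℬ i) n ⟨x, Submodule.subset_span hx⟩ := by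
  induction hx with
  | one => rw [map_one]; rfl
  | left ha hx ih =>
    rw [map_mul, lift_inl, ih, decomposeLeft_of_mem 𝒜 ℬ ha, DirectSum.of_mul_of]
    rfl
  | right hb hx ih =>
    rw [map_mul, lift_inr, ih, decomposeRight_of_mem 𝒜 ℬ hb, DirectSum.of_mul_of]
    rfl

instance : GradedAlgebra (gr 𝒜 ℬ) :=
  GradedAlgebra.ofAlgHom (gr 𝒜 ℬ) (lift (decomposeLeft 𝒜 ℬ) (decomposeRight 𝒜 ℬ))
    (by
      apply algHom_ext
      · intro a
        simp only [AlgHom.comp_apply, lift_inl, AlgHom.id_apply]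
        induction a using DirectSum.Decomposition.inductionOn 𝒜 with
        | zero => simp
        | homogeneous a =>
          rw [decomposeLeft_of_mem 𝒜 ℬ a.2, DirectSum.coeAlgHom_of]
        | add a a' h h' => rw [map_add, map_add, h, h', map_add]
      · intro b
        simp only [AlgHom.comp_apply, lift_inr, AlgHom.id_apply]
        induction b using DirectSum.Decomposition.inductionOn ℬ with
        | zero => simp
        | homogeneous b =>
          rw [decomposeRight_of_mem 𝒜 ℬ b.2, DirectSum.coeAlgHom_of]
        | add b b' h h' => rw [map_add, map_add, h, h', map_add])
    (by
      rintro n ⟨x, hx⟩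
      change lift (decomposeLeft 𝒜 ℬ) (decomposeRight 𝒜 ℬ) x = _
      have hx' := hx
      rw [gr] at hx'
      induction hx' using Submodule.span_induction with
      | mem x h => exact lift_decompose_of_word 𝒜 ℬ h
      | zero => rw [map_zero]; exact (map_zero (DirectSum.of (fun i ↦ gr 𝒜 ℬ i) n)).symm
      | add x y h h' ih ih' =>
        rw [map_add, ih h, ih' h', ← map_add]; rfl
      | smul r x h ih =>
        rw [map_smul, ih h]
        exact (map_smul (DirectSum.lof R ℕ (fun i ↦ gr 𝒜 ℬ i) n) r ⟨x, h⟩).symm)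

end FreeProd

/-! ## Connected graded algebras -/

/-- A connected graded algebra over `R`: an associative unital (not necessarily commutative)
`R`-algebra graded by `ℕ` whose unit map `R → A₀` is an isomorphism. -/
structure ConnGrAlg (R : Type u) [CommRing R] where
  /-- The underlying type. -/
  carrier : Type u
  [ring : Ring carrier]
  [algebra : Algebra R carrier]
  /-- The homogeneous parts. -/
  gr : ℕ → Submodule R carrier
  [graded : GradedAlgebra gr]
  connected : Function.Bijective (algebraMap R (gr 0))

namespace ConnGrAlg

attribute [instance] ConnGrAlg.ring ConnGrAlg.algebra ConnGrAlg.graded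

variable {R : Type u} [CommRing R]

instance : CoeSort (ConnGrAlg R) (Type u) := ⟨ConnGrAlg.carrier⟩

/-- Morphisms of connected graded algebras: degree-preserving `R`-algebra homomorphisms. -/
@[ext]
structure Hom (A B : ConnGrAlg R) where
  /-- The underlying homomorphism of graded algebras. -/
  hom : A.gr →ₐᵍ[R] B.gr

instance : Category (ConnGrAlg R) where
  Hom A B := Hom A B
  id A := ⟨GradedAlgHom.id R A.gr⟩
  comp f g := ⟨g.hom.comp f.hom⟩

/-- A morphism in `ConnGrAlg R` from an algebra homomorphism that preserves degrees. -/
def ofAlgHom {A B : ConnGrAlg R} (f : A →ₐ[R] B) (hf : ∀ {i a}, a ∈ A.gr i → f a ∈ B.gr i) :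
    A ⟶ B :=
  ⟨{ f with map_mem := hf }⟩

@[simp]
theorem ofAlgHom_apply {A B : ConnGrAlg R} (f : A →ₐ[R] B)
    (hf : ∀ {i a}, a ∈ A.gr i → f a ∈ B.gr i) (a : A) : (ofAlgHom f hf).hom a = f a := rfl

@[simp]
theorem id_apply (A : ConnGrAlg R) (a : A) : Hom.hom (𝟙 A) a = a := rfl

@[simp]
theorem comp_apply {A B C : ConnGrAlg R} (f : A ⟶ B) (g : B ⟶ C) (a : A) :
    (f ≫ g).hom a = g.hom (f.hom a) := rfl

theorem hom_ext {A B : ConnGrAlg R} {f g : A ⟶ B} (h : ∀ a, f.hom a = g.hom a) : f = g :=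
  Hom.ext (GradedAlgHom.ext h)

theorem exists_algebraMap_eq {A : ConnGrAlg R} {a : A} (ha : a ∈ A.gr 0) :
    ∃ r : R, algebraMap R A r = a := by
  obtain ⟨r, hr⟩ := A.connected.2 ⟨a, ha⟩
  exact ⟨r, congrArg Subtype.val hr⟩

theorem algebraMap_injective (A : ConnGrAlg R) : Function.Injective (algebraMap R A) :=
  fun _ _ h ↦ A.connected.1 (Subtype.ext h)

/-- The augmentation of a connected graded algebra: projection to degree zero. -/
def augmentation (A : ConnGrAlg R) : A →ₐ[R] R where
  __ := (RingEquiv.ofBijective (algebraMap R (A.gr 0)) A.connected).symm.toRingHom.comp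
    (GradedRing.projZeroRingHom' A.gr)
  commutes' r := by
    change (RingEquiv.ofBijective (algebraMap R (A.gr 0)) A.connected).symm
      (GradedRing.projZeroRingHom' A.gr (algebraMap R A r)) = r
    rw [RingEquiv.symm_apply_eq]
    exact GradedRing.projZeroRingHom'_apply_coe A.gr (algebraMap R (A.gr 0) r)

/-- The grading of the ground ring that is concentrated in degree zero. -/
def baseGr (R : Type u) [CommRing R] (n : ℕ) : Submodule R R := if n = 0 then ⊤ else ⊥

theorem mem_baseGr_zero (r : R) : r ∈ baseGr R 0 := by simp [baseGr]

theorem eq_zero_of_mem_baseGr {n : ℕ} (hn : n ≠ 0) {r : R} (h : r ∈ baseGr R n) : r = 0 := by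
  simpa [baseGr, hn] using h

instance : SetLike.GradedMonoid (baseGr R) where
  one_mem := mem_baseGr_zero 1
  mul_mem i j x y hx hy := by
    by_cases hi : i = 0
    · by_cases hj : j = 0
      · subst hi hj
        exact mem_baseGr_zero _
      · rw [eq_zero_of_mem_baseGr hj hy, mul_zero]
        exact zero_mem _
    · rw [eq_zero_of_mem_baseGr hi hx, zero_mul]
      exact zero_mem _

instance : GradedAlgebra (baseGr R) :=
  GradedAlgebra.ofAlgHom (baseGr R) (Algebra.ofId R _)
    (by ext)
    (by
      rintro i ⟨r, hr⟩
      change algebraMap R (DirectSum ℕ fun i ↦ baseGr R i) r = _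
      by_cases hi : i = 0
      · subst hi
        rfl
      · obtain rfl := eq_zero_of_mem_baseGr hi hr
        rw [map_zero]
        exact (map_zero (DirectSum.of (fun i ↦ baseGr R i) i)).symm)

/-- The ground ring as a connected graded algebra, concentrated in degree zero. -/
def base (R : Type u) [CommRing R] : ConnGrAlg R where
  carrier := R
  gr := baseGr R
  connected := ⟨fun _ _ h ↦ congrArg Subtype.val h, fun r ↦ ⟨r.1, Subtype.ext rfl⟩⟩

/-- The unique morphism from the ground ring. -/
def fromBase (A : ConnGrAlg R) : base R ⟶ A :=
  ofAlgHom (A := base R) (B := A) (Algebra.ofId R A) (by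
    intro i (r : R) (hr : r ∈ baseGr R i)
    change algebraMap R A r ∈ A.gr i
    by_cases hi : i = 0
    · subst hi
      exact SetLike.algebraMap_mem_graded A.gr r
    · obtain rfl := eq_zero_of_mem_baseGr hi hr
      rw [map_zero]
      exact zero_mem _)

theorem fromBase_uniq {A : ConnGrAlg R} (f : base R ⟶ A) : f = fromBase A :=
  hom_ext fun r ↦ f.hom.toAlgHom.commutes r

/-- The coproduct of two connected graded algebras: the free product. -/
def coprod (A B : ConnGrAlg R) : ConnGrAlg R where
  carrier := FreeProd R A B
  gr := FreeProd.gr A.gr B.gr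
  connected := by
    constructor
    · intro r s h
      have h' := congrArg (FreeProd.lift A.augmentation B.augmentation) (congrArg Subtype.val h)
      simpa using h'
    · rintro ⟨x, hx⟩
      suffices ∃ r : R, algebraMap R (FreeProd R A B) r = x by
        obtain ⟨r, hr⟩ := this
        exact ⟨r, Subtype.ext hr⟩
      rw [FreeProd.gr] at hx
      induction hx using Submodule.span_induction with
      | mem x h =>
        have key : ∀ n (x : FreeProd R A B), FreeProd.Word A.gr B.gr n x → n = 0 →
            ∃ r : R, algebraMap R (FreeProd R A B) r = x := by
          intro n x h
          induction h with
          | one => exact fun _ ↦ ⟨1, map_one _⟩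
          | left ha _ ih =>
            intro h
            obtain ⟨rfl, rfl⟩ := Nat.add_eq_zero_iff.1 h
            obtain ⟨r, rfl⟩ := exists_algebraMap_eq ha
            obtain ⟨s, rfl⟩ := ih rfl
            exact ⟨r * s, by simp⟩
          | right hb _ ih =>
            intro h
            obtain ⟨rfl, rfl⟩ := Nat.add_eq_zero_iff.1 h
            obtain ⟨r, rfl⟩ := exists_algebraMap_eq hb
            obtain ⟨s, rfl⟩ := ih rfl
            exact ⟨r * s, by simp⟩
        exact key 0 x h rfl
      | zero => exact ⟨0, map_zero _⟩
      | add x y _ _ h h' =>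
        obtain ⟨r, rfl⟩ := h
        obtain ⟨s, rfl⟩ := h'
        exact ⟨r + s, map_add _ _ _⟩
      | smul c x _ h =>
        obtain ⟨r, rfl⟩ := h
        exact ⟨c * r, by rw [map_mul, Algebra.smul_def]⟩

/-- The inclusion of the first summand. -/
def inl (A B : ConnGrAlg R) : A ⟶ coprod A B :=
  ofAlgHom (FreeProd.inl R A B) FreeProd.inl_mem

/-- The inclusion of the second summand. -/
def inr (A B : ConnGrAlg R) : B ⟶ coprod A B :=
  ofAlgHom (FreeProd.inr R A B) FreeProd.inr_mem

/-- The morphism out of the coproduct with given restrictions to the summands. -/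
def desc {A B C : ConnGrAlg R} (f : A ⟶ C) (g : B ⟶ C) : coprod A B ⟶ C :=
  ofAlgHom (A := coprod A B) (B := C) (FreeProd.lift f.hom.toAlgHom g.hom.toAlgHom) (by
    intro i a h
    exact FreeProd.lift_mem_of_mem (𝒜 := A.gr) (ℬ := B.gr) (𝒞 := C.gr)
      (f := f.hom.toAlgHom) (g := g.hom.toAlgHom)
      (fun h ↦ f.hom.map_mem h) (fun h ↦ g.hom.map_mem h) h)

@[simp]
theorem inl_desc {A B C : ConnGrAlg R} (f : A ⟶ C) (g : B ⟶ C) : inl A B ≫ desc f g = f :=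
  hom_ext fun a ↦ FreeProd.lift_inl f.hom.toAlgHom g.hom.toAlgHom a

@[simp]
theorem inr_desc {A B C : ConnGrAlg R} (f : A ⟶ C) (g : B ⟶ C) : inr A B ≫ desc f g = g :=
  hom_ext fun b ↦ FreeProd.lift_inr f.hom.toAlgHom g.hom.toAlgHom b

theorem coprod_ext {A B C : ConnGrAlg R} {f g : coprod A B ⟶ C}
    (h₁ : inl A B ≫ f = inl A B ≫ g) (h₂ : inr A B ≫ f = inr A B ≫ g) : f = g := by
  have : f.hom.toAlgHom = g.hom.toAlgHom :=
    FreeProd.algHom_ext (fun a ↦ congrArg (fun k ↦ Hom.hom k a) h₁)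
      (fun b ↦ congrArg (fun k ↦ Hom.hom k b) h₂)
  exact hom_ext fun x ↦ DFunLike.congr_fun this x

/-! ### The cartesian structure on the opposite category

Products in the opposite category are coproducts of connected graded algebras. -/

/-- The ground ring is initial. -/
def baseOpIsTerminal (R : Type u) [CommRing R] : IsTerminal (Opposite.op (base R)) :=
  IsTerminal.ofUniqueHom (fun A ↦ (fromBase A.unop).op)
    (fun _ f ↦ Quiver.Hom.unop_inj (fromBase_uniq f.unop))

/-- The free product with its two inclusions is a coproduct. -/
def coprodLimitCone (A B : (ConnGrAlg R)ᵒᵖ) : LimitCone (pair A B) where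
  cone := BinaryFan.mk (P := Opposite.op (coprod A.unop B.unop))
    (inl A.unop B.unop).op (inr A.unop B.unop).op
  isLimit := BinaryFan.IsLimit.mk _ (fun f g ↦ (desc f.unop g.unop).op)
    (fun f g ↦ Quiver.Hom.unop_inj (inl_desc f.unop g.unop))
    (fun f g ↦ Quiver.Hom.unop_inj (inr_desc f.unop g.unop))
    (fun f g _ h₁ h₂ ↦ Quiver.Hom.unop_inj (coprod_ext
      ((congrArg Quiver.Hom.unop h₁).trans (inl_desc f.unop g.unop).symm)
      ((congrArg Quiver.Hom.unop h₂).trans (inr_desc f.unop g.unop).symm)))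

instance : CartesianMonoidalCategory (ConnGrAlg R)ᵒᵖ :=
  .ofChosenFiniteProducts ⟨_, baseOpIsTerminal R⟩ coprodLimitCone

end ConnGrAlg

/-! ## Polynomial algebras -/

namespace ConnGrAlg

open Polynomial

variable {R : Type u} [CommRing R]

/-- The degree `n` part of the polynomial ring `R[X]` on a generator `X` of degree `d`: the
polynomials in which only monomials `X ^ k` with `k * d = n` occur. -/
def polyGr (R : Type u) [CommRing R] (d n : ℕ) : Submodule R R[X] where
  carrier := {p | ∀ k, p.coeff k ≠ 0 → k * d = n}
  zero_mem' := by simp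
  add_mem' := by
    intro p q hp hq k hk
    by_cases h : p.coeff k = 0
    · exact hq k (by simpa [h] using hk)
    · exact hp k h
  smul_mem' := by
    intro c p hp k hk
    exact hp k fun h ↦ hk (by simp [h])

theorem monomial_mem_polyGr (d k : ℕ) (r : R) : monomial k r ∈ polyGr R d (k * d) := by
  intro j hj
  rw [coeff_monomial] at hj
  by_cases h : k = j
  · rw [h]
  · simp [h] at hj

theorem X_mem_polyGr (d : ℕ) : (X : R[X]) ∈ polyGr R d d := by
  
  have h := monomial_mem_polyGr (R := R) d 1 1
  rwa [one_mul, monomial_one_one_eq_X] at h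

instance (d : ℕ) : SetLike.GradedMonoid (polyGr R d) where
  one_mem := by simpa using monomial_mem_polyGr (R := R) d 0 1
  mul_mem i j p q hp hq := by
    intro k hk
    rw [coeff_mul] at hk
    obtain ⟨⟨a, b⟩, hab, h⟩ := Finset.exists_ne_zero_of_sum_ne_zero hk
    have ha := hp a (left_ne_zero_of_mul h)
    have hb := hq b (right_ne_zero_of_mul h)
    replace hab : a + b = k := Finset.HasAntidiagonal.mem_antidiagonal.1 hab
    rw [← hab, ← ha, ← hb, add_mul]

instance (d : ℕ) : GradedAlgebra (polyGr R d) :=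
  GradedAlgebra.ofAlgHom (polyGr R d)
    (aeval (DirectSum.of (fun i ↦ polyGr R d i) d ⟨X, X_mem_polyGr d⟩))
    (by
      ext
      simp [DirectSum.coeAlgHom_of])
    (by
      rintro n ⟨p, hp⟩
      have key : ∀ k (r : R), aeval (DirectSum.of (fun i ↦ polyGr R d i) d ⟨X, X_mem_polyGr d⟩)
          (monomial k r) = DirectSum.of (fun i ↦ polyGr R d i) (k * d)
            ⟨monomial k r, monomial_mem_polyGr d k r⟩ := by
        intro k r
        rw [aeval_monomial, ← Algebra.smul_def, DirectSum.ofPow]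
        refine (map_smul (DirectSum.lof R ℕ (fun i ↦ polyGr R d i) (k • d)) r _).symm.trans ?_
        refine DirectSum.of_eq_of_gradedMonoid_eq (Sigma.subtype_ext (smul_eq_mul k d) ?_)
        change r • (X : R[X]) ^ k = monomial k r
        rw [smul_eq_C_mul, C_mul_X_pow_eq_monomial]
      change aeval _ p = _
      conv_lhs => rw [p.as_sum_support, map_sum]
      have h2 : (⟨p, hp⟩ : polyGr R d n) = ∑ k ∈ p.support.attach, ⟨monomial k.1 (p.coeff k.1), by
          have := monomial_mem_polyGr (R := R) d k.1 (p.coeff k.1)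
          rwa [hp k.1 (mem_support_iff.1 k.2)] at this⟩ := by
        apply Subtype.ext
        rw [AddSubmonoidClass.coe_finsetSum]
        rw [Finset.sum_attach p.support (fun k ↦ monomial k (p.coeff k))]
        exact p.as_sum_support
      rw [h2, map_sum, ← Finset.sum_attach]
      refine Finset.sum_congr rfl fun k _ ↦ ?_
      rw [key]
      exact DirectSum.of_eq_of_gradedMonoid_eq
        (Sigma.subtype_ext (hp k.1 (mem_support_iff.1 k.2)) rfl))

/-- The polynomial ring `R[X]` as a connected graded algebra, with the generator `X` in the
positive degree `n + 1`. -/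
def poly (R : Type u) [CommRing R] (n : ℕ) : ConnGrAlg R where
  carrier := R[X]
  gr := polyGr R (n + 1)
  connected := by
    constructor
    · intro r s h
      exact C_injective (congrArg Subtype.val h)
    · rintro ⟨p, hp⟩
      refine ⟨p.coeff 0, Subtype.ext ?_⟩
      change C (p.coeff 0) = p
      ext k
      rw [coeff_C]
      split_ifs with h
      · rw [h]
      · by_contra hk
        have := hp k (Ne.symm hk)
        simp_all

/-- The generator `X` of the polynomial ring. -/
def gen (R : Type u) [CommRing R] (n : ℕ) : poly R n := (X : R[X])

theorem gen_mem (n : ℕ) : gen R n ∈ (poly R n).gr (n + 1) := X_mem_polyGr (n + 1)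

/-- The morphism out of the polynomial ring that sends `X` to a given element of the same
degree. -/
def polyHom {n : ℕ} {B : ConnGrAlg R} (b : B) (hb : b ∈ B.gr (n + 1)) : poly R n ⟶ B :=
  ofAlgHom (A := poly R n) (B := B) (aeval (R := R) b) (by
    intro i (p : R[X]) (hp : p ∈ polyGr R (n + 1) i)
    change aeval b p ∈ B.gr i
    rw [aeval_eq_sum_range]
    refine sum_mem fun k _ ↦ ?_
    by_cases h : p.coeff k = 0
    · rw [h, zero_smul]
      exact zero_mem _
    · rw [← hp k h]
      exact Submodule.smul_mem _ _ (SetLike.pow_mem_graded k hb))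

@[simp]
theorem polyHom_gen {n : ℕ} {B : ConnGrAlg R} (b : B) (hb : b ∈ B.gr (n + 1)) :
    (polyHom b hb).hom (gen R n) = b :=
  aeval_X (R := R) b

theorem polyHom_ext {n : ℕ} {B : ConnGrAlg R} {f g : poly R n ⟶ B}
    (h : f.hom (gen R n) = g.hom (gen R n)) : f = g := by
  have : f.hom.toAlgHom = g.hom.toAlgHom := Polynomial.algHom_ext (R := R) h
  exact hom_ext fun x ↦ DFunLike.congr_fun this x

/-- The comultiplication `X ↦ X' + X''` of the polynomial ring. -/
def polyComul (R : Type u) [CommRing R] (n : ℕ) : poly R n ⟶ coprod (poly R n) (poly R n) :=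
  polyHom ((inl (poly R n) (poly R n)).hom (gen R n) + (inr (poly R n) (poly R n)).hom (gen R n))
    (add_mem ((inl _ _).hom.map_mem (gen_mem n)) ((inr _ _).hom.map_mem (gen_mem n)))

/-- The inverse `X ↦ -X` of the polynomial ring. -/
def polyInv (R : Type u) [CommRing R] (n : ℕ) : poly R n ⟶ poly R n :=
  polyHom (-gen R n) (neg_mem (gen_mem n))

/-- The counit `X ↦ 0` of the polynomial ring. -/
def polyCounit (R : Type u) [CommRing R] (n : ℕ) : poly R n ⟶ base R :=
  polyHom 0 (zero_mem _)

open Opposite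

/-- The comultiplication, read as a multiplication in the opposite category. -/
def polyMul (R : Type u) [CommRing R] (n : ℕ) :
    op (poly R n) ⊗ op (poly R n) ⟶ op (poly R n) := (polyComul R n).op

/-- The counit, read as a unit in the opposite category. -/
def polyOne (R : Type u) [CommRing R] (n : ℕ) : 𝟙_ (ConnGrAlg R)ᵒᵖ ⟶ op (poly R n) :=
  (polyCounit R n).op

theorem comp_polyMul {n : ℕ} {Z : (ConnGrAlg R)ᵒᵖ} (w : Z ⟶ op (poly R n) ⊗ op (poly R n)) :
    (w ≫ polyMul R n).unop.hom (gen R n) =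
      (w ≫ fst _ _).unop.hom (gen R n) + (w ≫ snd _ _).unop.hom (gen R n) := by
  change w.unop.hom ((polyComul R n).hom (gen R n)) = _
  rw [polyComul, polyHom_gen]
  exact map_add w.unop.hom _ _

theorem comp_polyInv {n : ℕ} {Z : (ConnGrAlg R)ᵒᵖ} (w : Z ⟶ op (poly R n)) :
    (w ≫ (polyInv R n).op).unop.hom (gen R n) = -w.unop.hom (gen R n) := by
  change w.unop.hom ((polyInv R n).hom (gen R n)) = _
  rw [polyInv, polyHom_gen]
  exact map_neg w.unop.hom _

theorem comp_polyOne {n : ℕ} {Z : (ConnGrAlg R)ᵒᵖ} (w : Z ⟶ 𝟙_ (ConnGrAlg R)ᵒᵖ) :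
    (w ≫ polyOne R n).unop.hom (gen R n) = 0 := by
  change w.unop.hom ((polyCounit R n).hom (gen R n)) = _
  rw [polyCounit, polyHom_gen]
  exact map_zero w.unop.hom

/-- The cogroup structure on the polynomial ring with `X` primitive. -/
instance (n : ℕ) : GrpObj (op (poly R n)) where
  one := polyOne R n
  mul := polyMul R n
  inv := (polyInv R n).op
  one_mul := by
    apply Quiver.Hom.unop_inj
    apply polyHom_ext
    rw [comp_polyMul, whiskerRight_fst, whiskerRight_snd, comp_polyOne, zero_add,
      leftUnitor_hom]
  mul_one := by
    apply Quiver.Hom.unop_inj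
    apply polyHom_ext
    rw [comp_polyMul, whiskerLeft_fst, whiskerLeft_snd, comp_polyOne, add_zero,
      rightUnitor_hom]
  mul_assoc := by
    apply Quiver.Hom.unop_inj
    apply polyHom_ext
    rw [comp_polyMul, whiskerRight_fst, whiskerRight_snd, comp_polyMul, ← Category.assoc,
      comp_polyMul, Category.assoc, whiskerLeft_fst, Category.assoc, whiskerLeft_snd,
      ← Category.assoc, comp_polyMul, add_assoc]
    simp
  left_inv := by
    apply Quiver.Hom.unop_inj
    apply polyHom_ext
    rw [comp_polyMul, lift_fst, lift_snd, comp_polyOne]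
    change (𝟙 _ ≫ (polyInv R n).op).unop.hom (gen R n) + _ = 0
    rw [comp_polyInv, neg_add_cancel]
  right_inv := by
    apply Quiver.Hom.unop_inj
    apply polyHom_ext
    rw [comp_polyMul, lift_fst, lift_snd, comp_polyOne]
    change _ + (𝟙 _ ≫ (polyInv R n).op).unop.hom (gen R n) = 0
    rw [comp_polyInv, add_neg_cancel]

end ConnGrAlg

/-! ## Cogroups -/

/-- The category of cogroups in the category of connected graded algebras, with respect to the
categorical coproduct. A cogroup is a group object in the opposite category, and a morphism of
cogroups is a morphism of the underlying algebras that is compatible with the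
comultiplications (and hence with counits and inverses). -/
abbrev CoGrp (R : Type u) [CommRing R] := (Grp (ConnGrAlg R)ᵒᵖ)ᵒᵖ

namespace CoGrp

open Opposite ConnGrAlg

variable {R : Type u} [CommRing R]

/-- The underlying connected graded algebra of a cogroup. -/
def alg (A : CoGrp R) : ConnGrAlg R := A.unop.X.unop

/-- The comultiplication `A ⟶ A ∗ A` of a cogroup. -/
def comul (A : CoGrp R) : A.alg ⟶ coprod A.alg A.alg := (MonObj.mul (X := A.unop.X)).unop

/-- The underlying morphism of connected graded algebras of a morphism of cogroups. -/
def algMap {A B : CoGrp R} (f : A ⟶ B) : A.alg ⟶ B.alg := f.unop.hom.hom.unop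

/-- The convolution `A ⟶ A ∗ A ⟶ B` of two morphisms of algebras out of a cogroup. This is the
group operation that the cogroup `A` induces on the set of morphisms from `A` to `B`. -/
def conv {A : CoGrp R} {B : ConnGrAlg R} (f g : A.alg ⟶ B) : A.alg ⟶ B := A.comul ≫ desc f g

/-- The cogroups whose underlying algebra is graded commutative: `a b = (-1) ^ (p q) b a` for all
`a` and `b` of degrees `p` and `q`. -/
def gradedCommutative (R : Type u) [CommRing R] : ObjectProperty (CoGrp R) := fun A ↦
  ∀ (p q : ℕ) (a b : A.alg), a ∈ A.alg.gr p → b ∈ A.alg.gr q → a * b = (-1) ^ (p * q) * (b * a)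

/-- The full subcategory of the cogroups whose underlying algebra is graded commutative. -/
abbrev Co (R : Type u) [CommRing R] := (gradedCommutative R).FullSubcategory

/-- The cogroups `A(n)`: `A(0)` is the ground ring with its trivial cogroup structure, and `A(n)`
for `n > 0` is the polynomial ring on a generator `X` of degree `n`, with comultiplication
`X ↦ X' + X''` and inverse `X ↦ -X`. -/
def std (R : Type u) [CommRing R] : ℕ → CoGrp R
  | 0 => op (Grp.trivial (ConnGrAlg R)ᵒᵖ)
  | n + 1 => op ⟨op (poly R n)⟩

/-- The generator `X` of `A(n + 1)`. -/
def X (R : Type u) [CommRing R] (n : ℕ) : (std R (n + 1)).alg := gen R n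

/-- The index set of the objects `A(n)` that are graded commutative over a field: all natural
numbers in characteristic two, and the even ones otherwise. -/
abbrev Index (R : Type u) [CommRing R] : Type := {n : ℕ // ringChar R = 2 ∨ Even n}

end CoGrp

end

/-! The free product `A ∗ A` keeps apart words such as `a'' b'` and `b' a''` (one prime for the
first factor, two for the second), and this noncommutativity makes cogroups rigid. The detecting
device is `act l`, a representation of `A ∗ A` on `A × A` depending on a linear functional `l`:
applied to `(0, 1)`, the word `a'' b'` with `a`, `b` of positive degree contributes `-l(b) a` to the
first component.

The ground ring is both initial and terminal, so every counit is the augmentation and the counit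
laws say that both projections of `Δ a` equal `a`. Let `x ≠ 0` have minimal positive degree `n` in a
graded commutative cogroup. A word of degree `n` has only one letter of positive degree, so `Δ x =
x' + x''` (`eq_inl_add_inr_of_minimal`). The word `x'' x'^k` in `(x' + x'')^(k+1)` shows that no
power of `x` vanishes (`pow_ne_zero_of_primitive`). If `n` is odd, then `2 x² = 0` forces
characteristic two; in every admissible case `x` commutes with all of `A`. If `y` of least degree
lay outside `K[x]`, a functional vanishing on `K[x]` but not at `y` would detect `x'' y'` in `Δ x Δ
y` and nothing in `Δ y Δ x`, although `x y = y x` (`mem_adjoin_of_primitive`). Hence `A` is the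
polynomial ring on the primitive element `x`.

A morphism `A(m) ⟶ A(n)` sends `X` to a homogeneous primitive element. No `c X^k` with `c ≠ 0`, `k ≥
2` is primitive, in any characteristic, because of the word `X'' X'^(k-1)`
(`eq_coeff_one_smul_gen`). So `X ↦ c X`, and `c = 0` unless the degrees agree. -/

noncomputable section

namespace ConnGrAlg

section CommRing

variable {R : Type u} [CommRing R] {A : ConnGrAlg R}

/-! ### The augmentation -/

theorem augmentation_algebraMap (r : R) : A.augmentation (algebraMap R A r) = r :=
  A.augmentation.commutes r

theorem augmentation_of_mem {i : ℕ} (hi : i ≠ 0) {a : A} (ha : a ∈ A.gr i) :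
    A.augmentation a = 0 := by
  have h : GradedRing.projZeroRingHom' A.gr a = 0 :=
    Subtype.ext (DirectSum.decompose_of_mem_ne A.gr ha hi)
  change (RingEquiv.ofBijective (algebraMap R (A.gr 0)) A.connected).symm
    (GradedRing.projZeroRingHom' A.gr a) = 0
  rw [h, map_zero]

/-- Both maps are the identity on scalars and kill all positive degrees. It follows that the ground
ring is terminal as well as initial. -/
theorem hom_base_eq_augmentation (f : A ⟶ base R) (a : A) :
    f.hom a = A.augmentation a := by
  induction a using DirectSum.Decomposition.inductionOn A.gr with
  | zero => exact (map_zero f.hom).trans (map_zero A.augmentation).symm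
  | @homogeneous i a =>
    obtain ⟨a, ha⟩ := a
    by_cases hi : i = 0
    · subst hi
      obtain ⟨r, rfl⟩ := exists_algebraMap_eq ha
      exact (f.hom.commutes r).trans (augmentation_algebraMap r).symm
    · exact (eq_zero_of_mem_baseGr (R := R) hi (f.hom.map_mem ha)).trans (augmentation_of_mem hi ha).symm
  | add a b ha hb =>
    rw [map_add A.augmentation, ← ha, ← hb]
    exact map_add f.hom a b

/-! ### A representation of the free product by block triangular matrices -/

/-- The projection of `A ∗ A` to the first factor. -/
def projLeft (A : ConnGrAlg R) : FreeProd R A A →ₐ[R] A :=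
  FreeProd.lift (AlgHom.id R A) ((Algebra.ofId R A).comp A.augmentation)

/-- The projection of `A ∗ A` to the second factor. -/
def projRight (A : ConnGrAlg R) : FreeProd R A A →ₐ[R] A :=
  FreeProd.lift ((Algebra.ofId R A).comp A.augmentation) (AlgHom.id R A)

theorem projLeft_mem {n : ℕ} {z : FreeProd R A A} (hz : z ∈ FreeProd.gr A.gr A.gr n) :
    projLeft A z ∈ A.gr n := by
  refine FreeProd.lift_mem_of_mem (fun h ↦ h) (fun {i b} h ↦ ?_) hz
  change algebraMap R A (A.augmentation b) ∈ A.gr i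
  by_cases hi : i = 0
  · subst hi
    exact SetLike.algebraMap_mem_graded A.gr _
  · rw [augmentation_of_mem hi h, map_zero]
    exact zero_mem _

/-- The action of the first factor on `A × A`: by the augmentation on the first component and by
multiplication on the second one. -/
def actLeft (A : ConnGrAlg R) : A →ₐ[R] Module.End R (A × A) :=
  (LinearMap.prodMapAlgHom R A A).comp
    (((Algebra.ofId R (Module.End R A)).comp A.augmentation).prod (Algebra.lmul R A))

theorem actLeft_apply (b u v : A) :
    actLeft A b (u, v) = (A.augmentation b • u, b * v) := rfl

/-- The action of the second factor on `A × A`: multiplication on the first component and the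
augmentation on the second one, conjugated by the unipotent map `(u, v) ↦ (u + l v • 1, v)`. -/
def actRight (l : A →ₗ[R] R) : A →ₐ[R] Module.End R (A × A) :=
  AlgHom.ofLinearMap
    (LinearMap.mk₂ R (fun (a : A) (p : A × A) ↦
      (a * p.1 - l p.2 • a + (A.augmentation a * l p.2) • (1 : A), A.augmentation a • p.2))
      (fun a b p ↦ Prod.ext
        (by simp only [map_add, add_mul, Prod.mk_add_mk, smul_add]; module)
        (by simp [add_smul]))
      (fun c a p ↦ Prod.ext
        (by simp only [map_smul, smul_mul_assoc, Prod.smul_mk, smul_eq_mul]; module)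
        (by simp [mul_smul]))
      (fun a p q ↦ Prod.ext
        (by simp only [map_add, mul_add, Prod.fst_add, Prod.snd_add, Prod.mk_add_mk]; module)
        (by simp))
      (fun c a p ↦ Prod.ext
        (by simp only [map_smul, mul_smul_comm, Prod.smul_fst, Prod.smul_snd, Prod.smul_mk,
              smul_eq_mul]; module)
        (smul_comm _ _ _)))
    (LinearMap.ext fun p ↦ by simp)
    (fun a b ↦ LinearMap.ext fun p ↦ Prod.ext
      (by
        simp only [LinearMap.mk₂_apply, Module.End.mul_apply, map_mul, map_smul, mul_add, mul_sub,
          mul_assoc, mul_smul_comm, mul_one, smul_eq_mul]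
        module)
      (by simp [mul_smul]))

theorem actRight_apply (l : A →ₗ[R] R) (a u v : A) :
    actRight l a (u, v) =
      (a * u - l v • a + (A.augmentation a * l v) • 1, A.augmentation a • v) := rfl

/-- The representation of `A ∗ A` on `A × A` by block triangular matrices. For `v = 1`, the upper
right corner records `- a * l b` for a product `a'' * b'` of elements of positive degrees, and
vanishes on the other alternating products of at least two factors. -/
def act (l : A →ₗ[R] R) : FreeProd R A A →ₐ[R] Module.End R (A × A) :=
  FreeProd.lift (actLeft A) (actRight l)

theorem act_inl (l : A →ₗ[R] R) (b u v : A) :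
    act l (FreeProd.inl R A A b) (u, v) = (A.augmentation b • u, b * v) := by
  rw [act, FreeProd.lift_inl, actLeft_apply]

theorem act_inr (l : A →ₗ[R] R) (a u v : A) :
    act l (FreeProd.inr R A A a) (u, v) =
      (a * u - l v • a + (A.augmentation a * l v) • 1, A.augmentation a • v) := by
  rw [act, FreeProd.lift_inr, actRight_apply]

theorem act_inl_add_inr (l : A →ₗ[R] R) {a : A} (ha : A.augmentation a = 0) (u v : A) :
    act l (FreeProd.inl R A A a + FreeProd.inr R A A a) (u, v) = (a * u - l v • a, a * v) := by
  rw [map_add, LinearMap.add_apply, act_inl, act_inr, ha]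
  simp

theorem act_inl_add_inr_pow (l : A →ₗ[R] R) {a : A} (ha : A.augmentation a = 0) {k : ℕ}
    (hk : ∀ i < k, l (a ^ i) = 0) :
    act l ((FreeProd.inl R A A a + FreeProd.inr R A A a) ^ k) (0, 1) = (0, a ^ k) := by
  induction k with
  | zero => simp
  | succ k ih =>
    rw [pow_succ', map_mul, Module.End.mul_apply, ih fun i hi ↦ hk i (by omega),
      act_inl_add_inr l ha, hk k (by omega), pow_succ']
    simp

/-- As `l` kills the lower powers, the only word of the expansion that contributes to the first
component is `a'' a'^k`. -/
theorem act_inl_add_inr_pow_succ (l : A →ₗ[R] R) {a : A} (ha : A.augmentation a = 0) {k : ℕ}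
    (hk : ∀ i < k, l (a ^ i) = 0) :
    act l ((FreeProd.inl R A A a + FreeProd.inr R A A a) ^ (k + 1)) (0, 1) =
      (-(l (a ^ k) • a), a ^ (k + 1)) := by
  rw [pow_succ', map_mul, Module.End.mul_apply, act_inl_add_inr_pow l ha hk,
    act_inl_add_inr l ha, pow_succ']
  simp

/-- The first component of the action on `(0, 1)` is computed twice: from primitivity of `c • a ^ (k
+ 1)`, and by expanding a power of `a' + a''`. -/
theorem smul_eq_of_primitive_smul_pow (l : A →ₗ[R] R) (Δ : A →ₐ[R] FreeProd R A A) {a : A}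
    (ha : A.augmentation a = 0) (hΔ : Δ a = FreeProd.inl R A A a + FreeProd.inr R A A a) {k : ℕ}
    (hk : ∀ i < k, l (a ^ i) = 0) {c : R}
    (hc : Δ (c • a ^ (k + 1)) =
      FreeProd.inl R A A (c • a ^ (k + 1)) + FreeProd.inr R A A (c • a ^ (k + 1))) :
    c • l (a ^ k) • a = l 1 • c • a ^ (k + 1) := by
  have hε : A.augmentation (c • a ^ (k + 1)) = 0 := by
    rw [map_smul, map_pow, ha, zero_pow k.succ_ne_zero, smul_zero]
  have h := congrArg (fun z ↦ act l z (0, 1)) hc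
  rw [act_inl_add_inr l hε, map_smul, map_pow, hΔ, map_smul, LinearMap.smul_apply,
    act_inl_add_inr_pow_succ l ha hk] at h
  simpa using congrArg Prod.fst h

/-- If `l` vanishes on a subalgebra `P` that contains all elements of degrees below `m`, then the
upper right corner of the representation vanishes on elements of degree `m`, after restriction
to `P`. -/
theorem act_apply_of_mem {l : A →ₗ[R] R} {P : Subalgebra R A} (hl : ∀ p ∈ P, l p = 0) {m : ℕ}
    (hP : ∀ j < m, ∀ a ∈ A.gr j, a ∈ P) {z : FreeProd R A A}
    (hz : z ∈ FreeProd.gr A.gr A.gr m) {v : A} (hv : v ∈ P) :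
    act l z (0, v) = (0, projLeft A z * v) := by
  have key : ∀ {n : ℕ} {z : FreeProd R A A}, FreeProd.Word A.gr A.gr n z → n ≤ m →
      act l z (0, v) = (0, projLeft A z * v) := by
    intro n z hz
    induction hz with
    | one => simp
    | @left i n a x ha hx ih =>
      intro hn
      rw [map_mul, Module.End.mul_apply, ih (by omega), act_inl, map_mul (projLeft A), mul_assoc]
      simp [projLeft]
    | @right i n b x hb hx ih =>
      intro hn
      rw [map_mul, Module.End.mul_apply, ih (by omega), act_inr, map_mul (projLeft A)]
      by_cases hi : i = 0
      · subst hi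
        -- A letter of degree zero is a scalar, for which the two corner terms of `act_inr` cancel.
        obtain ⟨r, rfl⟩ := exists_algebraMap_eq hb
        simp [projLeft, Algebra.smul_def, mul_comm r, mul_assoc]
      -- As `i > 0`, the rest `x` of the word has degree below `m`; so `l` is evaluated inside `P`.
      · have h : projLeft A x ∈ P := hP n (by omega) _ (projLeft_mem (Submodule.subset_span hx))
        rw [hl _ (mul_mem h hv)]
        simp [projLeft, Algebra.smul_def, mul_assoc]
  rw [FreeProd.gr] at hz
  induction hz using Submodule.span_induction with
  | mem z h => exact key h le_rfl
  | zero => simp [Prod.zero_eq_mk]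
  | add y z _ _ hy hz => simp [map_add, hy, hz, add_mul]
  | smul c z _ hz => simp [map_smul, hz]

/-! ### Elements of minimal positive degree -/

/-- In a nonzero word of degree `n`, a letter of positive degree already uses up the whole degree,
and all other letters are scalars. -/
theorem coprod_eq_inl_add_inr {n : ℕ} (hA : ∀ j, 0 < j → j < n → ∀ a ∈ A.gr j, a = 0)
    {z : FreeProd R A A} (hz : z ∈ FreeProd.gr A.gr A.gr n) :
    ∃ a b : A, z = FreeProd.inl R A A a + FreeProd.inr R A A b := by
  suffices FreeProd.gr A.gr A.gr n ≤
      LinearMap.range (FreeProd.inl R A A).toLinearMap ⊔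
        LinearMap.range (FreeProd.inr R A A).toLinearMap by
    obtain ⟨_, ⟨a, rfl⟩, _, ⟨b, rfl⟩, h⟩ := Submodule.mem_sup.1 (this hz)
    exact ⟨a, b, h.symm⟩
  rw [FreeProd.gr, Submodule.span_le]
  intro z hz
  have key : ∀ {k : ℕ} {z : FreeProd R A A}, FreeProd.Word A.gr A.gr k z → k ≤ n →
      z ∈ LinearMap.range (FreeProd.inl R A A).toLinearMap ⊔
        LinearMap.range (FreeProd.inr R A A).toLinearMap := by
    intro k z hz
    have scalar : ∀ {x : FreeProd R A A}, FreeProd.Word A.gr A.gr 0 x →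
        ∃ r : R, algebraMap R (FreeProd R A A) r = x := fun {x} hx ↦
      exists_algebraMap_eq (A := coprod A A) (a := x)
        (show x ∈ FreeProd.gr A.gr A.gr 0 from Submodule.subset_span hx)
    induction hz with
    | one => exact fun _ ↦ Submodule.mem_sup_left ⟨1, map_one (FreeProd.inl R A A)⟩
    | @left i k a x ha hx ih =>
      intro hk
      rcases Nat.eq_zero_or_pos i with rfl | hi
      · obtain ⟨r, rfl⟩ := exists_algebraMap_eq ha
        rw [AlgHom.commutes, ← Algebra.smul_def]
        exact Submodule.smul_mem _ _ (ih (by omega))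
      · rcases Nat.lt_or_ge i n with h | h
        · rw [hA i hi h a ha, map_zero, zero_mul]
          exact zero_mem _
        · obtain rfl : k = 0 := by omega
          obtain ⟨r, rfl⟩ := scalar hx
          rw [← Algebra.commutes, ← Algebra.smul_def]
          exact Submodule.smul_mem _ _ (Submodule.mem_sup_left ⟨a, rfl⟩)
    | @right i k a x ha hx ih =>
      intro hk
      rcases Nat.eq_zero_or_pos i with rfl | hi
      · obtain ⟨r, rfl⟩ := exists_algebraMap_eq ha
        rw [AlgHom.commutes, ← Algebra.smul_def]
        exact Submodule.smul_mem _ _ (ih (by omega))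
      · rcases Nat.lt_or_ge i n with h | h
        · rw [hA i hi h a ha, map_zero, zero_mul]
          exact zero_mem _
        · obtain rfl : k = 0 := by omega
          obtain ⟨r, rfl⟩ := scalar hx
          rw [← Algebra.commutes, ← Algebra.smul_def]
          exact Submodule.smul_mem _ _ (Submodule.mem_sup_right ⟨a, rfl⟩)
  exact key hz le_rfl

/-- An element of minimal positive degree is primitive for every comultiplication that is
counital. -/
theorem eq_inl_add_inr_of_minimal {n : ℕ} (hn : n ≠ 0)
    (hA : ∀ j, 0 < j → j < n → ∀ a ∈ A.gr j, a = 0) {a : A} (ha : a ∈ A.gr n)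
    {z : FreeProd R A A} (hz : z ∈ FreeProd.gr A.gr A.gr n)
    (hl : projLeft A z = a) (hr : projRight A z = a) :
    z = FreeProd.inl R A A a + FreeProd.inr R A A a := by
  obtain ⟨b, c, rfl⟩ := coprod_eq_inl_add_inr hA hz
  simp only [projLeft, projRight, map_add, FreeProd.lift_inl, FreeProd.lift_inr,
    AlgHom.comp_apply, AlgHom.id_apply, Algebra.ofId_apply] at hl hr
  -- The summands `b` and `c` are not known to be homogeneous, so each may differ from `a` by a
  -- scalar. Augmenting shows that these two scalars cancel.
  have h := congrArg A.augmentation hl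
  rw [map_add, augmentation_algebraMap, augmentation_of_mem hn ha] at h
  have hb : b = a - algebraMap R A (A.augmentation c) := eq_sub_of_add_eq hl
  have hc : c = a - algebraMap R A (A.augmentation b) := eq_sub_of_add_eq' hr
  have h' : FreeProd.inl R A A b + FreeProd.inr R A A c =
      FreeProd.inl R A A a + FreeProd.inr R A A a -
        algebraMap R (FreeProd R A A) (A.augmentation b + A.augmentation c) := by
    rw [congrArg (FreeProd.inl R A A) hb, congrArg (FreeProd.inr R A A) hc]
    simp only [map_sub, AlgHom.commutes, map_add]
    abel
  rw [h', h, map_zero, sub_zero]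

end CommRing

/-! ### Powers of a primitive element, and generation by it -/

section Field

variable {K : Type u} [Field K] {A : ConnGrAlg K}

theorem pow_ne_zero_of_primitive {n : ℕ} (hn : n ≠ 0) {x : A} (hx : x ∈ A.gr n) (hx0 : x ≠ 0)
    (Δ : A →ₐ[K] FreeProd K A A) (hΔ : Δ x = FreeProd.inl K A A x + FreeProd.inr K A A x) (k : ℕ) :
    x ^ k ≠ 0 := by
  induction k with
  | zero =>
    rw [pow_zero]
    intro h
    exact hx0 (by rw [← mul_one x, h, mul_zero])
  | succ k ih =>
    intro h0
    -- A functional that is nonzero at `x ^ k`, composed with the projection to degree `k * n`, also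
    -- kills the lower powers of `x`.
    obtain ⟨μ, hμ⟩ := not_forall.1 (mt (Module.forall_dual_apply_eq_zero_iff K (x ^ k)).1 ih)
    have hxk : x ^ k ∈ A.gr (k * n) := SetLike.pow_mem_graded k hx
    have h := act_inl_add_inr_pow_succ (μ.comp (GradedAlgebra.proj A.gr (k * n)))
      (augmentation_of_mem hn hx) (k := k) (by
        intro i hi
        have hxi : x ^ i ∈ A.gr (i * n) := SetLike.pow_mem_graded i hx
        rw [LinearMap.comp_apply, GradedAlgebra.proj_apply,
          DirectSum.decompose_of_mem_ne A.gr hxi, map_zero]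
        intro h
        exact hi.ne (Nat.eq_of_mul_eq_mul_right (Nat.pos_of_ne_zero hn) h))
    rw [← hΔ, ← map_pow, h0, map_zero, map_zero, LinearMap.zero_apply] at h
    have h1 := congrArg Prod.fst h
    rw [LinearMap.comp_apply, GradedAlgebra.proj_apply, DirectSum.decompose_of_mem_same A.gr hxk]
      at h1
    exact smul_ne_zero hμ hx0 (neg_eq_zero.1 h1.symm)

/-- If a primitive element `x` of positive degree commutes with all homogeneous elements of a
counital algebra, then the algebra is generated by `x`. -/
theorem mem_adjoin_of_primitive {n : ℕ} (hn : n ≠ 0) {x : A} (hx : x ∈ A.gr n) (hx0 : x ≠ 0)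
    (Δ : A →ₐ[K] FreeProd K A A)
    (hgr : ∀ m, ∀ a ∈ A.gr m, Δ a ∈ FreeProd.gr A.gr A.gr m)
    (hl : ∀ a, projLeft A (Δ a) = a)
    (hΔ : Δ x = FreeProd.inl K A A x + FreeProd.inr K A A x)
    (hcomm : ∀ m, ∀ a ∈ A.gr m, x * a = a * x) (m : ℕ) :
    ∀ a ∈ A.gr m, a ∈ Algebra.adjoin K {x} := by
  induction m using Nat.strong_induction_on with
  | h m ih =>
    intro y hy
    by_contra hyP
    -- The functional `l` vanishes on `K[x]` but not at `y`. On `(0, 1)`, the first component of `Δ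
    -- x Δ y` is then `-l(y) x` and that of `Δ y Δ x` is `0`.
    obtain ⟨l, hly, hlP⟩ := Submodule.exists_le_ker_of_notMem
      (p := Subalgebra.toSubmodule (Algebra.adjoin K {x})) hyP
    have hlP' : ∀ p ∈ Algebra.adjoin K {x}, l p = 0 := fun p hp ↦ hlP hp
    have hxP : x ∈ Algebra.adjoin K {x} := Algebra.self_mem_adjoin_singleton K x
    have h := congrArg (fun z ↦ act l (Δ z) (0, 1)) (hcomm m y hy)
    have hv {v : A} (hv : v ∈ Algebra.adjoin K {x}) : act l (Δ y) (0, v) = (0, y * v) := by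
      rw [act_apply_of_mem hlP' ih (hgr m y hy) hv, hl]
    simp only [map_mul, Module.End.mul_apply] at h
    rw [hv (one_mem _), hΔ, act_inl_add_inr l (augmentation_of_mem hn hx),
      act_inl_add_inr l (augmentation_of_mem hn hx), hlP' 1 (one_mem _)] at h
    simp only [mul_zero, mul_one, zero_smul, sub_zero, zero_sub] at h
    rw [hv hxP] at h
    exact smul_ne_zero hly hx0 (neg_eq_zero.1 (congrArg Prod.fst h))

end Field

end ConnGrAlg


/-! ### Counit laws and morphisms of cogroups -/

namespace ConnGrAlg

open Opposite

section CommRing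

variable {R : Type u} [CommRing R]

theorem lift_op_eq_desc {A B C : ConnGrAlg R} (f : A ⟶ C) (g : B ⟶ C) :
    CartesianMonoidalCategory.lift f.op g.op = (desc f g).op := by
  apply CartesianMonoidalCategory.hom_ext
  · rw [lift_fst]
    exact (congrArg Quiver.Hom.op (inl_desc f g)).symm
  · rw [lift_snd]
    exact (congrArg Quiver.Hom.op (inr_desc f g)).symm

theorem tensorHom_op_eq_desc {A B C D : ConnGrAlg R} (f : A ⟶ C) (g : B ⟶ D) :
    f.op ⊗ₘ g.op = (desc (f ≫ inl C D) (g ≫ inr C D)).op := by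
  rw [← lift_op_eq_desc]
  apply CartesianMonoidalCategory.hom_ext
  · exact (tensorHom_fst f.op g.op).trans (lift_fst (f ≫ inl C D).op (g ≫ inr C D).op).symm
  · exact (tensorHom_snd f.op g.op).trans (lift_snd (f ≫ inl C D).op (g ≫ inr C D).op).symm

theorem desc_apply {A B C : ConnGrAlg R} (f : A ⟶ C) (g : B ⟶ C) (z : coprod A B) :
    (desc f g).hom z = FreeProd.lift f.hom.toAlgHom g.hom.toAlgHom z := rfl

theorem hom_base_ext {A : ConnGrAlg R} (f g : A ⟶ base R) : f = g :=
  hom_ext fun a ↦ (hom_base_eq_augmentation f a).trans (hom_base_eq_augmentation g a).symm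

theorem fromBase_comp_eq (A : ConnGrAlg R) (f : A ⟶ base R) :
    (f ≫ fromBase A).hom.toAlgHom = (Algebra.ofId R A).comp A.augmentation :=
  AlgHom.ext fun a ↦ congrArg (algebraMap R A) (hom_base_eq_augmentation f a)

end CommRing

end ConnGrAlg

namespace CoGrp

open Opposite ConnGrAlg

section CommRing

variable {R : Type u} [CommRing R]

/-- The counit of a cogroup. -/
def counit (A : CoGrp R) : A.alg ⟶ base R := (MonObj.one (X := A.unop.X)).unop

/-- This is a unit law of the group object in the opposite category, with the counit identified with
the augmentation. -/
theorem projLeft_comul (A : CoGrp R) (a : A.alg) :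
    projLeft A.alg (A.comul.hom a) = a := by
  have h := congrArg Quiver.Hom.unop
    (MonObj.lift_comp_one_right (𝟙 A.unop.X) (fromBase A.alg).op)
  have h' : A.comul ≫ desc (𝟙 A.alg) (A.counit ≫ fromBase A.alg) = 𝟙 A.alg := by
    refine Eq.trans ?_ h
    rw [← Quiver.Hom.unop_op (desc _ _), ← lift_op_eq_desc]
    rfl
  have h₂ : (desc (𝟙 A.alg) (A.counit ≫ fromBase A.alg)).hom (A.comul.hom a) = a :=
    congrArg (fun f ↦ Hom.hom f a) h'
  rw [desc_apply, fromBase_comp_eq] at h₂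
  exact h₂

theorem projRight_comul (A : CoGrp R) (a : A.alg) :
    projRight A.alg (A.comul.hom a) = a := by
  have h := congrArg Quiver.Hom.unop
    (MonObj.lift_comp_one_left (fromBase A.alg).op (𝟙 A.unop.X))
  have h' : A.comul ≫ desc (A.counit ≫ fromBase A.alg) (𝟙 A.alg) = 𝟙 A.alg := by
    refine Eq.trans ?_ h
    rw [← Quiver.Hom.unop_op (desc _ _), ← lift_op_eq_desc]
    rfl
  have h₂ : (desc (A.counit ≫ fromBase A.alg) (𝟙 A.alg)).hom (A.comul.hom a) = a :=
    congrArg (fun f ↦ Hom.hom f a) h'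
  rw [desc_apply, fromBase_comp_eq] at h₂
  exact h₂

/-- A morphism of algebras that is compatible with the comultiplications, as a morphism of
cogroups. -/
def homMk {A B : CoGrp R} (f : A.alg ⟶ B.alg)
    (hf : f ≫ B.comul = A.comul ≫ desc (f ≫ inl _ _) (f ≫ inr _ _)) : A ⟶ B :=
  (Grp.homMk'' (A := B.unop) (B := A.unop) f.op
    -- Compatibility with counits is automatic, the ground ring being terminal.
    (Quiver.Hom.unop_inj (hom_base_ext _ _))
    ((congrArg Quiver.Hom.op hf).trans
      (congrArg (· ≫ MonObj.mul (X := A.unop.X)) (tensorHom_op_eq_desc f f).symm))).op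

theorem hom_ext {A B : CoGrp R} {f g : A ⟶ B} (h : algMap f = algMap g) : f = g :=
  Quiver.Hom.unop_inj (Grp.hom_ext _ _ (Quiver.Hom.unop_inj h))

theorem algMap_comul {A B : CoGrp R} (f : A ⟶ B) :
    algMap f ≫ B.comul = A.comul ≫ desc (algMap f ≫ inl _ _) (algMap f ≫ inr _ _) := by
  have h := IsMonHom.mul_hom f.unop.hom.hom
  rw [← Quiver.Hom.op_unop f.unop.hom.hom, tensorHom_op_eq_desc] at h
  exact congrArg Quiver.Hom.unop h

/-- An isomorphism of algebras that is compatible with the comultiplications, as an isomorphism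
of cogroups. -/
def isoMk {A B : CoGrp R} (e : A.alg ≅ B.alg)
    (he : e.hom ≫ B.comul = A.comul ≫ desc (e.hom ≫ inl _ _) (e.hom ≫ inr _ _)) : A ≅ B where
  hom := homMk e.hom he
  inv := homMk e.inv (by
    rw [Iso.inv_comp_eq, ← Category.assoc, he, Category.assoc]
    conv_lhs => rw [← Category.comp_id A.comul]
    congr 1
    apply coprod_ext
    · rw [← Category.assoc, inl_desc, Category.assoc, inl_desc, Iso.hom_inv_id_assoc,
        Category.comp_id]
    · rw [← Category.assoc, inr_desc, Category.assoc, inr_desc, Iso.hom_inv_id_assoc,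
        Category.comp_id])
  hom_inv_id := hom_ext e.hom_inv_id
  inv_hom_id := hom_ext e.inv_hom_id

end CommRing

end CoGrp

/-! ### Isomorphisms of connected graded algebras -/

namespace ConnGrAlg

section CommRing

variable {R : Type u} [CommRing R]

/-- A bijective morphism of connected graded algebras is an isomorphism. -/
def isoOfBijective {A B : ConnGrAlg R} (f : A ⟶ B) (hf : Function.Bijective f.hom) : A ≅ B :=
  let e : A ≃ₐ[R] B := AlgEquiv.ofBijective f.hom.toAlgHom hf
  { hom := f
    inv := ofAlgHom (A := B) (B := A) e.symm.toAlgHom (by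
      intro i b hb
      obtain ⟨a, rfl⟩ := hf.2 b
      have ha : e.symm.toAlgHom (f.hom a) = a := e.symm_apply_apply a
      classical
      rw [ha, ← DirectSum.sum_support_decompose A.gr a]
      refine sum_mem fun j _ ↦ ?_
      by_cases hj : j = i
      · subst hj
        exact SetLike.coe_mem _
      -- The component of `a` in a degree `j ≠ i` maps to the component of the homogeneous image in
      -- degree `j`, which is zero.
      · have h : ((DirectSum.decompose A.gr a j : A.gr j) : A) = 0 := by
          apply hf.1
          rw [map_zero, map_directSumDecompose A.gr B.gr]
          exact DirectSum.decompose_of_mem_ne B.gr hb (Ne.symm hj)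
        rw [h]
        exact zero_mem _)
    hom_inv_id := hom_ext fun a ↦ e.symm_apply_apply a
    inv_hom_id := hom_ext fun b ↦ e.apply_symm_apply b }

end CommRing

end ConnGrAlg


/-! ### Polynomial rings and their primitive elements -/

namespace ConnGrAlg

open Polynomial

section CommRing

variable {R : Type u} [CommRing R]

theorem polyHom_apply {n : ℕ} {B : ConnGrAlg R} (b : B) (hb : b ∈ B.gr (n + 1)) (p : R[X]) :
    (polyHom b hb).hom p = aeval b p := rfl

theorem polyComul_gen (n : ℕ) : (polyComul R n).hom (gen R n) =
    FreeProd.inl R _ _ (gen R n) + FreeProd.inr R _ _ (gen R n) := polyHom_gen _ _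

/-- Compatibility with the comultiplication of a morphism out of a polynomial ring means that
the image of the generator is primitive. -/
theorem polyComul_desc_gen {n : ℕ} {B : ConnGrAlg R} (f : poly R n ⟶ B) :
    (polyComul R n ≫ desc (f ≫ inl B B) (f ≫ inr B B)).hom (gen R n) =
      FreeProd.inl R B B (f.hom (gen R n)) + FreeProd.inr R B B (f.hom (gen R n)) := by
  rw [comp_apply, polyComul_gen]
  refine (map_add (desc (f ≫ inl B B) (f ≫ inr B B)).hom _ _).trans ?_
  exact congrArg₂ (· + ·)
    (FreeProd.lift_inl (f ≫ inl B B).hom.toAlgHom (f ≫ inr B B).hom.toAlgHom _)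
    (FreeProd.lift_inr (f ≫ inl B B).hom.toAlgHom (f ≫ inr B B).hom.toAlgHom _)

theorem polyHom_smul_gen_comp_polyComul {n : ℕ} (c : R) :
    polyHom (c • gen R n) (Submodule.smul_mem _ c (gen_mem n)) ≫ polyComul R n =
      polyComul R n ≫ desc
        (polyHom (c • gen R n) (Submodule.smul_mem _ c (gen_mem n)) ≫ inl _ _)
        (polyHom (c • gen R n) (Submodule.smul_mem _ c (gen_mem n)) ≫ inr _ _) := by
  refine polyHom_ext (Eq.trans ?_ (polyComul_desc_gen _).symm)
  rw [comp_apply, polyHom_gen, map_smul, polyComul_gen, map_smul, map_smul]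
  exact smul_add c _ _

theorem neg_one_pow_mul_eq_one {A : Type*} [Ring A] [Algebra R A] {n : ℕ}
    (hn : ringChar R = 2 ∨ Even n) (m : ℕ) : (-1 : A) ^ (n * m) = 1 := by
  rcases hn with h | h
  · have : CharP R 2 := ringChar.of_eq h
    have h1 : (-1 : A) = 1 := by
      rw [← map_one (algebraMap R A), ← map_neg, CharTwo.neg_eq]
    rw [h1, one_pow]
  · exact (h.mul_right m).neg_one_pow

/-- A homogeneous polynomial is a monomial. -/
theorem eq_smul_pow_of_mem_polyGr {d i k : ℕ} {p : R[X]} (hp : p ∈ polyGr R (d + 1) i)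
    (hk : p.coeff k ≠ 0) : p = p.coeff k • X ^ k := by
  ext j
  rw [coeff_smul, coeff_X_pow, smul_eq_mul, mul_ite, mul_one, mul_zero]
  split_ifs with h
  · rw [h]
  · by_contra hj
    exact h (Nat.eq_of_mul_eq_mul_right d.succ_pos ((hp j hj).trans (hp k hk).symm))

end CommRing

section Field

variable {K : Type u} [Field K]

/-- The powers of `b` are nonzero and lie in distinct degrees, so projecting to one degree isolates
one coefficient. -/
theorem polyHom_injective {n : ℕ} {B : ConnGrAlg K} {b : B} (hb : b ∈ B.gr (n + 1))
    (h0 : ∀ k, b ^ k ≠ 0) : Function.Injective (polyHom b hb).hom := by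
  rw [injective_iff_map_eq_zero]
  intro (p : K[X]) hp
  rw [polyHom_apply] at hp
  refine Polynomial.ext fun k ↦ ?_
  have h := congrArg (GradedAlgebra.proj B.gr (k * (n + 1))) hp
  have hmem (i : ℕ) : p.coeff i • b ^ i ∈ B.gr (i * (n + 1)) :=
    Submodule.smul_mem _ _ (SetLike.pow_mem_graded i hb)
  -- The range must cover all of `p` and also the index `k`, which may exceed the degree of `p`.
  rw [aeval_eq_sum_range' (n := max (p.natDegree + 1) (k + 1)) (by omega), map_sum,
    Finset.sum_eq_single k, GradedAlgebra.proj_apply, DirectSum.decompose_of_mem_same B.gr (hmem k),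
    map_zero] at h
  · exact (smul_eq_zero.1 h).resolve_right (h0 k)
  · intro i _ hi
    rw [GradedAlgebra.proj_apply, DirectSum.decompose_of_mem_ne B.gr (hmem i)]
    exact fun h ↦ hi (Nat.eq_of_mul_eq_mul_right n.succ_pos h)
  · intro hk
    exact absurd (Finset.mem_range.2 (by omega)) hk

theorem polyHom_surjective {n : ℕ} {B : ConnGrAlg K} {b : B} (hb : b ∈ B.gr (n + 1))
    (h : ∀ m, ∀ a ∈ B.gr m, a ∈ Algebra.adjoin K {b}) :
    Function.Surjective (polyHom b hb).hom := by
  intro a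
  suffices a ∈ Algebra.adjoin K {b} by
    rw [Algebra.adjoin_singleton_eq_range_aeval] at this
    exact this
  induction a using DirectSum.Decomposition.inductionOn B.gr with
  | zero => exact zero_mem _
  | homogeneous a => exact h _ _ a.2
  | add _ _ h₁ h₂ => exact add_mem h₁ h₂

/-- The primitive homogeneous elements of positive degree of a polynomial ring are linear. -/
theorem eq_coeff_one_smul_gen {m n : ℕ} {p : K[X]} (hp : p ∈ polyGr K (n + 1) (m + 1))
    (h : (polyComul K n).hom p =
      FreeProd.inl K (poly K n) (poly K n) p + FreeProd.inr K (poly K n) (poly K n) p) :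
    p = p.coeff 1 • (X : K[X]) := by
  by_cases h0 : ∀ k, p.coeff k = 0
  · rw [h0 1, zero_smul]
    exact Polynomial.ext h0
  obtain ⟨k, hk⟩ := not_forall.1 h0
  have hpk := eq_smul_pow_of_mem_polyGr hp hk
  rcases k with _ | _ | k
  · have := hp 0 hk
    omega
  · simpa using hpk
  · exfalso
    rw [hpk] at h
    -- The exponent is now `k + 2`. The coefficient at `k + 1` is one on `X ^ (k + 1)` and zero on
    -- all lower powers, including `1`, so the lemma gives `c X = 0`.
    have hX := smul_eq_of_primitive_smul_pow (A := poly K n) (lcoeff K (k + 1))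
      (polyComul K n).hom.toAlgHom (augmentation_of_mem n.succ_ne_zero (gen_mem n))
      (polyComul_gen n) (k := k + 1) (by
        intro i hi
        change (X ^ i : K[X]).coeff (k + 1) = 0
        rw [coeff_X_pow, if_neg (by omega)]) h
    have hX' : p.coeff (k + 1 + 1) • (X ^ (k + 1) : K[X]).coeff (k + 1) • (X : K[X]) =
      (1 : K[X]).coeff (k + 1) • p.coeff (k + 1 + 1) • (X : K[X]) ^ (k + 1 + 1) := hX
    rw [coeff_X_pow_self, one_smul, coeff_one, if_neg (by omega), zero_smul] at hX'
    exact smul_ne_zero hk X_ne_zero hX'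

end Field

end ConnGrAlg

/-! ### Classification of the cogroups and of their morphisms -/

namespace CoGrp

open Opposite ConnGrAlg

section CommRing

variable {R : Type u} [CommRing R]

/-- Nonzero homogeneous elements have degrees that are multiples of `n`, so the sign is always one
and ordinary commutativity suffices. -/
theorem gradedCommutative_std {n : ℕ} (hn : ringChar R = 2 ∨ Even n) :
    gradedCommutative R (std R n) := by
  cases n with
  | zero =>
    intro p q (a : R) (b : R) (ha : a ∈ baseGr R p) (hb : b ∈ baseGr R q)
    change a * b = (-1) ^ (p * q) * (b * a)
    by_cases hp : p = 0
    · rw [hp, zero_mul, pow_zero, one_mul, mul_comm]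
    · rw [eq_zero_of_mem_baseGr hp ha, zero_mul, mul_zero, mul_zero]
  | succ n =>
    intro p q (a : Polynomial R) (b : Polynomial R) (ha : a ∈ polyGr R (n + 1) p) _
    change a * b = (-1) ^ (p * q) * (b * a)
    by_cases h : ∀ k, a.coeff k = 0
    · rw [show a = 0 from Polynomial.ext h, zero_mul, mul_zero, mul_zero]
    · obtain ⟨k, hk⟩ := not_forall.1 h
      rw [← ha k hk, mul_comm k, mul_assoc, neg_one_pow_mul_eq_one hn, one_mul, mul_comm]

end CommRing

section Field

variable {K : Type u} [Field K]

theorem exists_iso_std (A : CoGrp K) (hA : gradedCommutative K A) :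
    ∃ n : Index K, Nonempty (std K n.1 ≅ A) := by
  classical
  by_cases h : ∃ n, n ≠ 0 ∧ ∃ x ∈ A.alg.gr n, x ≠ 0
  · obtain ⟨hn, x, hx, hx0⟩ := Nat.find_spec h
    have hmin := fun j (hj : j < Nat.find h) ↦ Nat.find_min h hj
    generalize Nat.find h = n at hn hx hmin
    have hmin' : ∀ j, 0 < j → j < n → ∀ a ∈ A.alg.gr j, a = 0 := fun j hj hjn a ha ↦
      by_contra fun ha0 ↦ hmin j hjn ⟨hj.ne', a, ha, ha0⟩
    have hgr : ∀ m, ∀ a ∈ A.alg.gr m, A.comul.hom a ∈ FreeProd.gr A.alg.gr A.alg.gr m :=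
      fun m a ha ↦ A.comul.hom.map_mem ha
    have hΔ : A.comul.hom x = FreeProd.inl K A.alg A.alg x + FreeProd.inr K A.alg A.alg x :=
      eq_inl_add_inr_of_minimal hn hmin' hx (hgr n x hx) (projLeft_comul A x)
        (projRight_comul A x)
    have hpow := pow_ne_zero_of_primitive hn hx hx0 A.comul.hom.toAlgHom hΔ
    have hsign : ringChar K = 2 ∨ Even n := by
      by_contra hcon
      obtain ⟨h2, hodd⟩ := not_or.1 hcon
      rw [Nat.not_even_iff_odd] at hodd
      -- In odd degree, `x * x = -(x * x)`; since `x ^ 2 ≠ 0`, this gives `2 = 0` in `K`.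
      have hxx := hA n n x x hx hx
      rw [(hodd.mul hodd).neg_one_pow, neg_one_mul, eq_neg_iff_add_eq_zero, ← two_smul K,
        ← pow_two] at hxx
      have h2' : ((2 : ℕ) : K) = 0 := by
        exact_mod_cast (smul_eq_zero.1 hxx).resolve_right (hpow 2)
      exact h2 (((Nat.dvd_prime Nat.prime_two).1 (ringChar.dvd h2')).resolve_left
        CharP.ringChar_ne_one)
    have hcomm : ∀ m, ∀ a ∈ A.alg.gr m, x * a = a * x := fun m a ha ↦ by
      rw [hA n m x a hx ha, neg_one_pow_mul_eq_one hsign, one_mul]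
    have hgen := mem_adjoin_of_primitive hn hx hx0 A.comul.hom.toAlgHom hgr (projLeft_comul A)
      hΔ hcomm
    obtain ⟨d, rfl⟩ := Nat.exists_eq_succ_of_ne_zero hn
    refine ⟨⟨d + 1, hsign⟩, ⟨isoMk (A := std K (d + 1))
      (isoOfBijective (polyHom x hx) ⟨polyHom_injective hx hpow, polyHom_surjective hx hgen⟩) ?_⟩⟩
    -- Compatibility with comultiplications need only be checked on the generator, where it says
    -- that `x` is primitive.
    refine polyHom_ext (Eq.trans ?_ (polyComul_desc_gen (polyHom x hx)).symm)
    change A.comul.hom ((polyHom x hx).hom (gen K d)) = _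
    rw [polyHom_gen, hΔ]
  · have h0 : ∀ n, n ≠ 0 → ∀ x ∈ A.alg.gr n, x = 0 := fun n hn x hx ↦
      by_contra fun hx0 ↦ h ⟨n, hn, x, hx, hx0⟩
    refine ⟨⟨0, .inr Even.zero⟩, ⟨isoMk (A := std K 0)
      (isoOfBijective (fromBase A.alg) ⟨algebraMap_injective A.alg, fun a ↦ ?_⟩) ?_⟩⟩
    · suffices a ∈ (⊥ : Subalgebra K A.alg) from Algebra.mem_bot (R := K) (A := A.alg).1 this
      induction a using DirectSum.Decomposition.inductionOn A.alg.gr with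
      | zero => exact zero_mem _
      | @homogeneous i a =>
        by_cases hi : i = 0
        · subst hi
          exact Algebra.mem_bot.2 (exists_algebraMap_eq a.2)
        · rw [h0 i hi _ a.2]
          exact zero_mem _
      | add _ _ h₁ h₂ => exact add_mem h₁ h₂
    · exact (fromBase_uniq _).trans (fromBase_uniq _).symm

/-- Morphisms of cogroups preserve primitive elements, and the homogeneous primitive elements of
positive degree in the target are linear. -/
theorem algMap_X (m n : ℕ) (f : std K (m + 1) ⟶ std K (n + 1)) :
    (algMap f).hom (X K m) = ((algMap f).hom (X K m) : Polynomial K).coeff 1 • X K n := by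
  refine eq_coeff_one_smul_gen (m := m) ((algMap f).hom.map_mem (gen_mem m)) ?_
  have h := congrArg (fun g ↦ Hom.hom g (X K m)) (algMap_comul f)
  exact h.trans (polyComul_desc_gen _)

theorem subsingleton_hom_std {m n : ℕ} (h : ¬(m = n ∧ 0 < n)) :
    Subsingleton (std K m ⟶ std K n) := by
  refine ⟨fun f g ↦ hom_ext ?_⟩
  rcases m with _ | m
  · exact (fromBase_uniq _).trans (fromBase_uniq _).symm
  rcases n with _ | n
  · exact hom_base_ext _ _
  have key (f : std K (m + 1) ⟶ std K (n + 1)) : (algMap f).hom (X K m) = 0 := by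
    have h₁ : (algMap f).hom (X K m) ∈ polyGr K (n + 1) (m + 1) :=
      (algMap f).hom.map_mem (gen_mem m)
    have h₂ : ((algMap f).hom (X K m) : Polynomial K).coeff 1 = 0 := by
      -- A nonzero linear coefficient would force the degrees `m + 1` and `n + 1` to agree.
      by_contra hc
      have := h₁ 1 hc
      omega
    rw [algMap_X, h₂, zero_smul]
  exact polyHom_ext ((key f).trans (key g).symm)

/-- The endomorphism `X ↦ c X` of `A(n + 1)`. -/
def scale (n : ℕ) (c : K) : std K (n + 1) ⟶ std K (n + 1) :=
  homMk (A := std K (n + 1)) (B := std K (n + 1))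
    (polyHom (c • gen K n) (Submodule.smul_mem _ c (gen_mem n))) (polyHom_smul_gen_comp_polyComul c)

theorem algMap_scale_X (n : ℕ) (c : K) : (algMap (scale n c)).hom (X K n) = c • X K n :=
  polyHom_gen (c • gen K n) (Submodule.smul_mem _ c (gen_mem n))

/-- The endomorphisms of `A(n + 1)` are parametrized by the ground field. -/
def endEquiv (n : ℕ) : (std K (n + 1) ⟶ std K (n + 1)) ≃ K where
  toFun f := ((algMap f).hom (X K n) : Polynomial K).coeff 1
  invFun := scale n
  left_inv f := hom_ext (polyHom_ext ((algMap_scale_X n _).trans (algMap_X n n f).symm))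
  right_inv c := by
    change ((algMap (scale n c)).hom (X K n) : Polynomial K).coeff 1 = c
    rw [algMap_scale_X]
    change (c • (Polynomial.X : Polynomial K)).coeff 1 = c
    simp

theorem algMap_X_eq_endEquiv_smul (n : ℕ) (f : std K (n + 1) ⟶ std K (n + 1)) :
    (algMap f).hom (X K n) = endEquiv n f • X K n := algMap_X n n f

theorem endEquiv_comp (n : ℕ) (f g : std K (n + 1) ⟶ std K (n + 1)) :
    endEquiv n (f ≫ g) = endEquiv n f * endEquiv n g := by
  rw [← Equiv.eq_symm_apply]
  refine hom_ext (polyHom_ext (Eq.trans ?_ (algMap_scale_X n _).symm))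
  change (algMap g).hom ((algMap f).hom (X K n)) = _
  rw [algMap_X_eq_endEquiv_smul n f, map_smul, algMap_X_eq_endEquiv_smul n g, smul_smul]

theorem conv_X (n : ℕ) {B : ConnGrAlg K} (f g : (std K (n + 1)).alg ⟶ B) :
    (conv f g).hom (X K n) = f.hom (X K n) + g.hom (X K n) := by
  change (desc f g).hom ((polyComul K n).hom (gen K n)) = _
  rw [polyComul_gen]
  refine (map_add (desc f g).hom _ _).trans ?_
  exact congrArg₂ (· + ·) (FreeProd.lift_inl f.hom.toAlgHom g.hom.toAlgHom _)
    (FreeProd.lift_inr f.hom.toAlgHom g.hom.toAlgHom _)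

theorem algMap_endEquiv_symm_add (n : ℕ) (f g : std K (n + 1) ⟶ std K (n + 1)) :
    algMap ((endEquiv n).symm (endEquiv n f + endEquiv n g)) = conv (algMap f) (algMap g) := by
  refine polyHom_ext ((algMap_scale_X n _).trans (Eq.trans ?_ (conv_X n _ _).symm))
  rw [algMap_X_eq_endEquiv_smul n f, algMap_X_eq_endEquiv_smul n g, add_smul]

end Field

end CoGrp

end

theorem corollary1p5 (R : Type u) [Field R] :
    -- the `A(n)` in question lie in the category, and the full subcategory on them is equivalent
    -- to the whole category through the inclusion
    (∃ h : ObjectProperty.ofObj (fun n : CoGrp.Index R ↦ CoGrp.std R n.1) ≤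
        CoGrp.gradedCommutative R, (ObjectProperty.ιOfLE h).IsEquivalence) ∧
    -- all sets of morphisms between different objects, and those with `m = n = 0`, are trivial
    (∀ (m n : ℕ) (hm : CoGrp.gradedCommutative R (CoGrp.std R m))
        (hn : CoGrp.gradedCommutative R (CoGrp.std R n)), ¬(m = n ∧ 0 < n) →
      Nonempty (Unique ((⟨CoGrp.std R m, hm⟩ : CoGrp.Co R) ⟶ ⟨CoGrp.std R n, hn⟩))) ∧
    -- the endomorphisms of `A(n)`, `n > 0`, are the maps `X ↦ c X` with `c` in `R`; addition in
    -- `R` is convolution, and multiplication in `R` is composition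
    (∀ (n : ℕ) (hn : CoGrp.gradedCommutative R (CoGrp.std R (n + 1))),
      ∃ e : ((⟨CoGrp.std R (n + 1), hn⟩ : CoGrp.Co R) ⟶ ⟨CoGrp.std R (n + 1), hn⟩) ≃ R,
        (∀ f, (CoGrp.algMap f.hom).hom (CoGrp.X R n) = e f • CoGrp.X R n) ∧
        (∀ f g, e (f ≫ g) = e f * e g) ∧
        (∀ f g, CoGrp.algMap (e.symm (e f + e g)).hom =
          CoGrp.conv (CoGrp.algMap f.hom) (CoGrp.algMap g.hom))) := by
  refine ⟨?_, ?_, ?_⟩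
  · have h : ObjectProperty.ofObj (fun n : CoGrp.Index R ↦ CoGrp.std R n.1) ≤
        CoGrp.gradedCommutative R := by
      rintro _ ⟨n⟩
      exact CoGrp.gradedCommutative_std n.2
    refine ⟨h, ?_⟩
    have : (ObjectProperty.ιOfLE h).EssSurj := ⟨fun A ↦ by
      obtain ⟨n, ⟨e⟩⟩ := CoGrp.exists_iso_std A.obj A.property
      exact ⟨⟨CoGrp.std R n.1, ObjectProperty.ofObj_apply _ n⟩,
        ⟨(CoGrp.gradedCommutative R).isoMk e⟩⟩⟩
    -- Fullness and faithfulness hold for any inclusion of full subcategories.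
    exact { }
  · intro m n hm hn hmn
    have := CoGrp.subsingleton_hom_std (K := R) hmn
    -- The required element is the zero morphism, which factors through the trivial cogroup.
    let f : CoGrp.std R m ⟶ CoGrp.std R n :=
      ((default : (CoGrp.std R n).unop ⟶ Grp.trivial _) ≫
        (default : Grp.trivial _ ⟶ (CoGrp.std R m).unop)).op
    exact ⟨⟨⟨⟨f⟩⟩, fun g ↦ ObjectProperty.hom_ext _ (Subsingleton.elim _ _)⟩⟩
  · intro n hn
    refine ⟨(ObjectProperty.fullyFaithfulι _).homEquiv.trans (CoGrp.endEquiv n), ?_, ?_, ?_⟩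
    · exact fun f ↦ CoGrp.algMap_X_eq_endEquiv_smul n f.hom
    · exact fun f g ↦ CoGrp.endEquiv_comp n f.hom g.hom
    · exact fun f g ↦ CoGrp.algMap_endEquiv_symm_add n f.hom g.hom
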